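/- Let $E=(E^0,E^1,r,s)$ be a directed graph with countable sets $E^0$ of vertices and $E^1$ of edges (infinitely many edges may leave a vertex), and let $R$ be a commutative ring with unit. The Leavitt path algebra $L_R(E)$ is the universal (not necessarily unital) associative $R$-algebra generated by pairwise orthogonal idempotents $v$ ($v\in E^0$) and elements $e,e^*$ ($e\in E^1$) subject to $s(e)e=er(e)=e$, $r(e)e^*=e^*s(e)=e^*$, $e^*f=\delta_{e,f}\,r(e)$ for all $e,f\in E^1$, and $v=\sum_{s(e)=v}ee^*$ for every vertex $v$ with $0<|s^{-1}(v)|<\infty$. For $v\in E^0$ let $T(v)$ be the set of all vertices $w$ such that there is a path (possibly of length zero) from $v$ to $w$. A vertex $v$ is a line point if no $w\in T(v)$ emits two or more edges and no $w\in T(v)$ is the base of a closed path of positive length. A minimal left (right) ideal is a nonzero left (right) ideal which contains no left (right) ideals other than $0$ and itself. **Proposition 5.5.** For every vertex $v\in E^0$ the following are equivalent: 1. $L_R(E)v$ is a minimal left ideal of $L_R(E)$; 2. $vL_R(E)$ is a minimal right ideal of $L_R(E)$; 3. $v$ is a line point and $R$ is a field; 4. $vL_R(E)v=Rv$ and $R$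 is a field. -/

import Mathlib

universe u w z

namespace Leavitt

/-! ### Graphs

A directed graph is a quiver on its type `V` of vertices: an edge `e : a ⟶ b` has source `a` and
range `b`, `Quiver.Path a b` is the type of finite paths from `a` to `b` (vertices being the paths
of length zero), and `OutEdges v` is the set of all edges with source `v`. -/

section Graph

variable {V : Type u} [Quiver.{w} V]

/-- The edges with source `v`, each recorded with its range. -/
abbrev OutEdges (v : V) : Type (max u w) := Σ a : V, (v ⟶ a)

/-- The tree of `v`: all vertices which can be reached from `v` by a path, `v` included. -/
def tree (v : V) : Set V := {a | Nonempty (Quiver.Path v a)}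

/-- A vertex is a bifurcation if it emits at least two edges. -/
def IsBifurcation (v : V) : Prop := ∃ e f : OutEdges v, e ≠ f

/-- There is a closed path (of positive length) based at `v`. -/
def IsBaseOfClosedPath (v : V) : Prop := ∃ p : Quiver.Path v v, 0 < p.length

/-- A line point: no vertex of its tree is a bifurcation or the base of a closed path. -/
def IsLinePoint (v : V) : Prop := ∀ a ∈ tree v, ¬ IsBifurcation a ∧ ¬ IsBaseOfClosedPath a

end Graph

/-! ### Leavitt families -/

/-- A Leavitt family of the graph `V` in a (not necessarily unital) ring `A`: elements `p v` for
the vertices, `s e` for the edges and `t e` for the ghost edges `e*`. -/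
structure IsLeavittFamily (V : Type u) [Quiver.{w} V] {A : Type z} [NonUnitalRing A]
    (p : V → A) (s t : ∀ {a b : V}, (a ⟶ b) → A) : Prop where
  idem : ∀ a : V, p a * p a = p a
  orth : ∀ a b : V, a ≠ b → p a * p b = 0
  source_edge : ∀ {a b : V} (e : a ⟶ b), p a * s e = s e
  edge_range : ∀ {a b : V} (e : a ⟶ b), s e * p b = s e
  range_ghost : ∀ {a b : V} (e : a ⟶ b), p b * t e = t e
  ghost_source : ∀ {a b : V} (e : a ⟶ b), t e * p a = t e
  ghost_edge : ∀ {a b : V} (e : a ⟶ b), t e * s e = p b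
  ghost_edge_ne : ∀ {a b a' b' : V} (e : a ⟶ b) (f : a' ⟶ b'),
    (⟨a, b, e⟩ : Quiver.Total V) ≠ ⟨a', b', f⟩ → t e * s f = 0
  vertex_eq_sum : ∀ (a : V) [Fintype (OutEdges a)], Nonempty (OutEdges a) →
    p a = ∑ e : OutEdges a, s e.2 * t e.2

/-! ### The Leavitt path algebra

It is built as the free associative (non-unital) `R`-algebra on the symbols `v`, `e`, `e*` modulo
the relations of a Leavitt family. -/

/-- The generating symbols: vertices, edges and ghost edges. -/
inductive Gen (V : Type u) [Quiver.{w} V] : Type (max u w)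
  | vertex (a : V) : Gen V
  | edge {a b : V} (e : a ⟶ b) : Gen V
  | ghost {a b : V} (e : a ⟶ b) : Gen V

/-- The free associative non-unital `R`-algebra on the generating symbols. -/
abbrev FreeAlg (R : Type z) [CommRing R] (V : Type u) [Quiver.{w} V] : Type (max u w z) :=
  MonoidAlgebra R (FreeSemigroup (Gen V))

noncomputable section

variable (R : Type z) [CommRing R] {V : Type u} [Quiver.{w} V]

/-- A generating symbol as an element of the free algebra. -/
def gen (x : Gen V) : FreeAlg R V := MonoidAlgebra.single (FreeSemigroup.of x) 1

/-- The defining relations. -/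
inductive Rel : FreeAlg R V → FreeAlg R V → Prop
  | idem (a : V) : Rel (gen R (.vertex a) * gen R (.vertex a)) (gen R (.vertex a))
  | orth (a b : V) (h : a ≠ b) : Rel (gen R (.vertex a) * gen R (.vertex b)) 0
  | source_edge {a b : V} (e : a ⟶ b) :
      Rel (gen R (.vertex a) * gen R (.edge e)) (gen R (.edge e))
  | edge_range {a b : V} (e : a ⟶ b) :
      Rel (gen R (.edge e) * gen R (.vertex b)) (gen R (.edge e))
  | range_ghost {a b : V} (e : a ⟶ b) :
      Rel (gen R (.vertex b) * gen R (.ghost e)) (gen R (.ghost e))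
  | ghost_source {a b : V} (e : a ⟶ b) :
      Rel (gen R (.ghost e) * gen R (.vertex a)) (gen R (.ghost e))
  | ghost_edge {a b : V} (e : a ⟶ b) :
      Rel (gen R (.ghost e) * gen R (.edge e)) (gen R (.vertex b))
  | ghost_edge_ne {a b a' b' : V} (e : a ⟶ b) (f : a' ⟶ b')
      (h : (⟨a, b, e⟩ : Quiver.Total V) ≠ ⟨a', b', f⟩) :
      Rel (gen R (.ghost e) * gen R (.edge f)) 0
  | vertex_eq_sum (a : V) [Fintype (OutEdges a)] (h : Nonempty (OutEdges a)) :
      Rel (gen R (.vertex a))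
        (∑ e : OutEdges a, gen R (.edge e.2) * gen R (.ghost e.2))

variable (V) in
/-- The congruence generated by the `R`-multiples of the defining relations. (The multiples are
needed because the free algebra has no unit.) -/
def con : RingCon (FreeAlg R V) :=
  ringConGen fun x y => ∃ (r : R) (x' y' : FreeAlg R V), Rel R x' y' ∧ x = r • x' ∧ y = r • y'

theorem con_of_rel {x y : FreeAlg R V} (h : Rel R x y) : con R V x y :=
  RingConGen.Rel.of _ _ ⟨1, x, y, h, (one_smul _ _).symm, (one_smul _ _).symm⟩

theorem con_smul (r : R) {x y : FreeAlg R V} (h : con R V x y) : con R V (r • x) (r • y) := by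
  change RingConGen.Rel _ x y at h
  change RingConGen.Rel _ (r • x) (r • y)
  induction h with
  | of x y h =>
    obtain ⟨c, x', y', h, rfl, rfl⟩ := h
    exact .of _ _ ⟨r * c, x', y', h, (mul_smul _ _ _).symm, (mul_smul _ _ _).symm⟩
  | refl x => exact .refl _
  | symm _ ih => exact ih.symm
  | trans _ _ ih₁ ih₂ => exact ih₁.trans ih₂
  | add _ _ ih₁ ih₂ => simpa only [smul_add] using ih₁.add ih₂
  | mul _ h₂ ih₁ _ => simpa only [smul_mul_assoc] using ih₁.mul h₂

end

end Leavitt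

/-- The Leavitt path algebra of the graph `V` with coefficients in `R`. -/
def LeavittPathAlgebra (R : Type z) [CommRing R] (V : Type u) [Quiver.{w} V] :
    Type (max u w z) :=
  (Leavitt.con R V).Quotient

namespace LeavittPathAlgebra

open Leavitt

noncomputable section

variable (R : Type z) [CommRing R] {V : Type u} [Quiver.{w} V]

instance : AddCommGroup (LeavittPathAlgebra R V) :=
  inferInstanceAs (AddCommGroup (con R V).Quotient)

instance : Mul (LeavittPathAlgebra R V) :=
  inferInstanceAs (Mul (con R V).Quotient)

instance : NonUnitalRing (LeavittPathAlgebra R V) where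
  left_distrib := by
    rintro ⟨x⟩ ⟨y⟩ ⟨c⟩
    exact congrArg (Quot.mk _) (mul_add x y c)
  right_distrib := by
    rintro ⟨x⟩ ⟨y⟩ ⟨c⟩
    exact congrArg (Quot.mk _) (add_mul x y c)
  zero_mul := by
    rintro ⟨x⟩
    exact congrArg (Quot.mk _) (zero_mul x)
  mul_zero := by
    rintro ⟨x⟩
    exact congrArg (Quot.mk _) (mul_zero x)
  mul_assoc := by
    rintro ⟨x⟩ ⟨y⟩ ⟨c⟩
    exact congrArg (Quot.mk _) (mul_assoc x y c)

variable (V) in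
/-- The quotient map from the free algebra. -/
def mk (x : FreeAlg R V) : LeavittPathAlgebra R V := Quot.mk _ x

theorem mk_add (x y : FreeAlg R V) : mk R V (x + y) = mk R V x + mk R V y := rfl

theorem mk_mul (x y : FreeAlg R V) : mk R V (x * y) = mk R V x * mk R V y := rfl

theorem mk_zero : mk R V 0 = 0 := rfl

theorem mk_surjective : Function.Surjective (mk R V) := Quot.mk_surjective

theorem mk_eq {x y : FreeAlg R V} (h : con R V x y) : mk R V x = mk R V y := Quot.sound h

instance : SMul R (LeavittPathAlgebra R V) where
  smul r := Quot.map (r • ·) fun _ _ h => con_smul R r h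

theorem mk_smul (r : R) (x : FreeAlg R V) : mk R V (r • x) = r • mk R V x := rfl

instance : Module R (LeavittPathAlgebra R V) where
  one_smul := by
    rintro ⟨x⟩
    exact congrArg (Quot.mk _) (one_smul R x)
  mul_smul := by
    rintro r c ⟨x⟩
    exact congrArg (Quot.mk _) (mul_smul r c x)
  smul_zero := fun r => congrArg (Quot.mk _) (smul_zero r)
  smul_add := by
    rintro r ⟨x⟩ ⟨y⟩
    exact congrArg (Quot.mk _) (smul_add r x y)
  add_smul := by
    rintro r c ⟨x⟩
    exact congrArg (Quot.mk _) (add_smul r c x)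
  zero_smul := by
    rintro ⟨x⟩
    exact congrArg (Quot.mk _) (zero_smul R x)

instance : IsScalarTower R (LeavittPathAlgebra R V) (LeavittPathAlgebra R V) where
  smul_assoc := by
    rintro r ⟨x⟩ ⟨y⟩
    exact congrArg (Quot.mk _) (smul_mul_assoc r x y)

instance : SMulCommClass R (LeavittPathAlgebra R V) (LeavittPathAlgebra R V) where
  smul_comm := by
    rintro r ⟨x⟩ ⟨y⟩
    exact congrArg (Quot.mk _) (mul_smul_comm r x y).symm

/-- The vertex `a` as an element of the Leavitt path algebra. -/
def vertex (a : V) : LeavittPathAlgebra R V := mk R V (gen R (.vertex a))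

/-- The edge `e` as an element of the Leavitt path algebra. -/
def edge {a b : V} (e : a ⟶ b) : LeavittPathAlgebra R V := mk R V (gen R (.edge e))

/-- The ghost edge `e*` as an element of the Leavitt path algebra. -/
def ghost {a b : V} (e : a ⟶ b) : LeavittPathAlgebra R V := mk R V (gen R (.ghost e))

theorem mk_sum {ι : Type*} (s : Finset ι) (f : ι → FreeAlg R V) :
    mk R V (∑ i ∈ s, f i) = ∑ i ∈ s, mk R V (f i) :=
  map_sum (⟨⟨mk R V, rfl⟩, mk_add R⟩ : FreeAlg R V →+ LeavittPathAlgebra R V) f s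

/-- The generators of the Leavitt path algebra form a Leavitt family. -/
theorem isLeavittFamily :
    IsLeavittFamily V (vertex R) (fun {_ _} e => edge R e) (fun {_ _} e => ghost R e) where
  idem a := mk_eq R (con_of_rel R (.idem a))
  orth a b h := mk_eq R (con_of_rel R (.orth a b h))
  source_edge e := mk_eq R (con_of_rel R (.source_edge e))
  edge_range e := mk_eq R (con_of_rel R (.edge_range e))
  range_ghost e := mk_eq R (con_of_rel R (.range_ghost e))
  ghost_source e := mk_eq R (con_of_rel R (.ghost_source e))
  ghost_edge e := mk_eq R (con_of_rel R (.ghost_edge e))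
  ghost_edge_ne e f h := mk_eq R (con_of_rel R (.ghost_edge_ne e f h))
  vertex_eq_sum a _ h := (mk_eq R (con_of_rel R (.vertex_eq_sum a h))).trans (mk_sum R _ _)

/-- The universal property: every Leavitt family in an `R`-algebra `A` is the image of the
generators under exactly one homomorphism of `R`-algebras. -/
theorem existsUnique_lift {A : Type*} [NonUnitalRing A] [Module R A] [IsScalarTower R A A]
    [SMulCommClass R A A] {p : V → A} {s t : ∀ {a b : V}, (a ⟶ b) → A}
    (h : IsLeavittFamily V p s t) :
    ∃! φ : LeavittPathAlgebra R V →ₙₐ[R] A, (∀ a, φ (vertex R a) = p a) ∧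
      (∀ {a b : V} (e : a ⟶ b), φ (edge R e) = s e) ∧
      (∀ {a b : V} (e : a ⟶ b), φ (ghost R e) = t e) := by
  let g : Gen V → A := fun x => match x with
    | .vertex a => p a
    | .edge e => s e
    | .ghost e => t e
  let F : FreeAlg R V →ₙₐ[R] A := MonoidAlgebra.liftMagma R (FreeSemigroup.lift g)
  have hF : ∀ x, F (gen R x) = g x := fun x => by simp [F, gen]
  have hrel : ∀ x y, Rel R x y → F x = F y := by
    intro x y hxy
    cases hxy with
    | idem a => simpa [hF] using h.idem a
    | orth a b hab => simpa [hF] using h.orth a b hab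
    | source_edge e => simpa [hF] using h.source_edge e
    | edge_range e => simpa [hF] using h.edge_range e
    | range_ghost e => simpa [hF] using h.range_ghost e
    | ghost_source e => simpa [hF] using h.ghost_source e
    | ghost_edge e => simpa [hF] using h.ghost_edge e
    | ghost_edge_ne e f hne => simpa [hF] using h.ghost_edge_ne e f hne
    | vertex_eq_sum a ha => simpa [hF] using h.vertex_eq_sum a ha
  have hcon : ∀ x y, con R V x y → F x = F y := by
    intro x y hxy
    change RingConGen.Rel _ x y at hxy
    induction hxy with
    | of x y h =>
      obtain ⟨c, x', y', h, rfl, rfl⟩ := h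
      rw [map_smul, map_smul, hrel _ _ h]
    | refl x => rfl
    | symm _ ih => exact ih.symm
    | trans _ _ ih₁ ih₂ => exact ih₁.trans ih₂
    | add _ _ ih₁ ih₂ => rw [map_add, map_add, ih₁, ih₂]
    | mul _ _ ih₁ ih₂ => rw [map_mul, map_mul, ih₁, ih₂]
  let φ : LeavittPathAlgebra R V →ₙₐ[R] A :=
    { toFun := Quot.lift F hcon
      map_smul' := by
        rintro r ⟨x⟩
        exact map_smul F r x
      map_zero' := map_zero F
      map_add' := by
        rintro ⟨x⟩ ⟨y⟩
        exact map_add F x y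
      map_mul' := by
        rintro ⟨x⟩ ⟨y⟩
        exact map_mul F x y }
  refine ⟨φ, ⟨fun a => hF _, fun e => hF _, fun e => hF _⟩, ?_⟩
  rintro ψ ⟨h₁, h₂, h₃⟩
  let q : FreeAlg R V →ₙₐ[R] LeavittPathAlgebra R V :=
    { toFun := mk R V
      map_smul' := mk_smul R
      map_zero' := rfl
      map_add' := mk_add R
      map_mul' := mk_mul R }
  have key : ψ.comp q = F := by
    refine MonoidAlgebra.nonUnitalAlgHom_ext' R (FreeSemigroup.hom_ext (funext fun x => ?_))
    change ψ (mk R V (gen R x)) = F (gen R x)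
    rw [hF]
    cases x with
    | vertex a => exact h₁ a
    | edge e => exact h₂ e
    | ghost e => exact h₃ e
  ext x
  obtain ⟨x, rfl⟩ := mk_surjective R x
  exact DFunLike.congr_fun key x

end

end LeavittPathAlgebra

/-! ### One-sided ideals of a ring which need not have a unit -/

namespace Leavitt

variable {A : Type z} [NonUnitalRing A]

/-- An additive subgroup which is a left ideal. -/
def IsLeftIdeal (I : AddSubgroup A) : Prop := ∀ a : A, ∀ x ∈ I, a * x ∈ I

/-- An additive subgroup which is a right ideal. -/
def IsRightIdeal (I : AddSubgroup A) : Prop := ∀ a : A, ∀ x ∈ I, x * a ∈ I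

/-- A minimal left ideal: a nonzero left ideal which contains no left ideals other than `0` and
itself. -/
def IsMinimalLeftIdeal (I : AddSubgroup A) : Prop :=
  IsLeftIdeal I ∧ I ≠ ⊥ ∧ ∀ J : AddSubgroup A, IsLeftIdeal J → J ≤ I → J = ⊥ ∨ J = I

/-- A minimal right ideal: a nonzero right ideal which contains no right ideals other than `0` and
itself. -/
def IsMinimalRightIdeal (I : AddSubgroup A) : Prop :=
  IsRightIdeal I ∧ I ≠ ⊥ ∧ ∀ J : AddSubgroup A, IsRightIdeal J → J ≤ I → J = ⊥ ∨ J = I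

/-- The set `A x = {a x : a ∈ A}`. -/
def leftMultiples (x : A) : AddSubgroup A := (AddMonoidHom.mulRight x).range

/-- The set `x A = {x a : a ∈ A}`. -/
def rightMultiples (x : A) : AddSubgroup A := (AddMonoidHom.mulLeft x).range

end Leavitt

namespace LeavittPathAlgebra

open Leavitt

noncomputable section

/-! ### A representation on functions

The algebra acts on the functions `V × ℕ × ℤ → R`; the last coordinate records degrees. -/

section Representation

variable {V : Type u} [Quiver.{w} V] [Countable V] [∀ a b : V, Countable (a ⟶ b)]

/-! Write L for the algebra. The passage to line points goes through the corner vLv: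
`CornerGenerates` follows from minimality of Lv, and also from vLv = Rv over a field, and it spreads
along paths to every vertex of the tree (`CornerGenerates.of_path`). Three test elements then
suffice. The element rv shows that a nonzero r is invertible; ee* excludes a second edge f, since x
ee* = v would give f = x e(e*f) = 0; and v - p* excludes a closed path p.

The last test, like the nonvanishing of vertices, needs a concrete representation. L acts on all
functions `V × ℕ × ℤ → R`, edges and ghost edges acting by transport along injections that raise the
ℤ-degree by one. The degree shows p* ≠ v, while p* and v agree on the constant function 1; so v - p*
kills 1 and cannot be a right factor of v.

Conversely, at a line point pp* = v for each path p from v, and parallel paths from v coincide.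
Hence the monomials pq* spanning Lv behave like matrix units: each has a dual that sends it to v and
kills the others (`exists_dual_monomial`). Any nonzero x in Lv thus satisfies yx = rv with r ≠ 0,
which is minimality over a field. Left multiplication by v sends each monomial to v or 0, so vLv =
Rv. Right ideals are handled by the involution e ↔ e*, which fixes v. -/

theorem exists_branching (a : V) : ∃ f : OutEdges a × ℕ → ℕ,
    Function.Injective f ∧ (Nonempty (OutEdges a) → Function.Surjective f) := by
  by_cases h : Nonempty (OutEdges a)
  -- The factor ℕ makes the product countably infinite however many edges `a` emits, so finite and
  -- infinite emitters are treated alike.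
  · obtain ⟨f⟩ := nonempty_equiv_of_countable (α := OutEdges a × ℕ) (β := ℕ)
    exact ⟨f, f.injective, fun _ => f.surjective⟩
  · exact ⟨Prod.snd, fun x => (h ⟨x.1⟩).elim, fun h' => (h h').elim⟩

/-- The cylinder map attached to an edge. -/
def cylinder {a : V} (e : OutEdges a) (z : ℕ × ℤ) : ℕ × ℤ :=
  ((exists_branching a).choose (e, z.1), z.2 + 1)

theorem cylinder_inj {a : V} {e f : OutEdges a} {y z : ℕ × ℤ}
    (h : cylinder e y = cylinder f z) : e = f ∧ y = z := by
  have h1 := (exists_branching a).choose_spec.1 (congrArg Prod.fst h)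
  have h2 : y.2 + 1 = z.2 + 1 := congrArg Prod.snd h
  have h3 : y.1 = z.1 := congrArg Prod.snd h1
  exact ⟨congrArg Prod.fst h1, Prod.ext h3 (by omega)⟩

theorem cylinder_injective {a : V} (e : OutEdges a) : Function.Injective (cylinder e) :=
  fun _ _ h => (cylinder_inj h).2

theorem exists_cylinder_eq {a : V} (h : Nonempty (OutEdges a)) (z : ℕ × ℤ) :
    ∃ (e : OutEdges a) (y : ℕ × ℤ), cylinder e y = z := by
  obtain ⟨⟨e, n⟩, hn⟩ := (exists_branching a).choose_spec.2 h z.1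
  -- Degrees lie in ℤ so that this predecessor always exists.
  exact ⟨e, (n, z.2 - 1), Prod.ext hn (by simp [cylinder])⟩

variable (R : Type z) [CommRing R]

open Classical in
/-- The operator of a vertex: restriction to its fibre. -/
def vertexOp {V : Type u} (a : V) : Module.End R (V × ℕ × ℤ → R) where
  toFun ξ x := if x.1 = a then ξ x else 0
  map_add' ξ η := by ext x; by_cases h : x.1 = a <;> simp [h]
  map_smul' r ξ := by ext x; by_cases h : x.1 = a <;> simp [h]

open Classical in
/-- The operator of an edge. -/
def edgeOp {a b : V} (e : a ⟶ b) : Module.End R (V × ℕ × ℤ → R) where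
  toFun ξ x := if x.1 = a then
    Function.extend (cylinder ⟨b, e⟩) (fun y => ξ (b, y)) 0 x.2 else 0
  map_add' ξ η := by
    ext x
    by_cases h : x.1 = a
    · by_cases hx : ∃ y, cylinder ⟨b, e⟩ y = x.2
      · obtain ⟨y, hy⟩ := hx
        simp [h, ← hy, (cylinder_injective (⟨b, e⟩ : OutEdges a)).extend_apply]
      · simp [h, Function.extend_apply' _ _ _ hx]
    · simp [h]
  map_smul' r ξ := by
    ext x
    by_cases h : x.1 = a
    · by_cases hx : ∃ y, cylinder ⟨b, e⟩ y = x.2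
      · obtain ⟨y, hy⟩ := hx
        simp [h, ← hy, (cylinder_injective (⟨b, e⟩ : OutEdges a)).extend_apply]
      · simp [h, Function.extend_apply' _ _ _ hx]
    · simp [h]

open Classical in
/-- The operator of a ghost edge. -/
def ghostOp {a b : V} (e : a ⟶ b) : Module.End R (V × ℕ × ℤ → R) where
  toFun ξ x := if x.1 = b then ξ (a, cylinder ⟨b, e⟩ x.2) else 0
  map_add' ξ η := by ext x; by_cases h : x.1 = b <;> simp [h]
  map_smul' r ξ := by ext x; by_cases h : x.1 = b <;> simp [h]

open Classical in
theorem vertexOp_apply {V : Type u} (a : V) (ξ : V × ℕ × ℤ → R) (x : V × ℕ × ℤ) :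
    vertexOp R a ξ x = if x.1 = a then ξ x else 0 := rfl

open Classical in
theorem ghostOp_apply {a b : V} (e : a ⟶ b) (ξ : V × ℕ × ℤ → R) (x : V × ℕ × ℤ) :
    ghostOp R e ξ x = if x.1 = b then ξ (a, cylinder ⟨b, e⟩ x.2) else 0 := rfl

theorem edgeOp_apply_of_ne {a b : V} (e : a ⟶ b) (ξ : V × ℕ × ℤ → R) {x : V × ℕ × ℤ}
    (h : x.1 ≠ a) : edgeOp R e ξ x = 0 := if_neg h

theorem edgeOp_apply_cylinder {a b : V} (e : a ⟶ b) (ξ : V × ℕ × ℤ → R) (y : ℕ × ℤ) :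
    edgeOp R e ξ (a, cylinder ⟨b, e⟩ y) = ξ (b, y) :=
  (if_pos rfl).trans ((cylinder_injective (⟨b, e⟩ : OutEdges a)).extend_apply _ _ _)

theorem edgeOp_apply_of_notMem {a b : V} (e : a ⟶ b) (ξ : V × ℕ × ℤ → R) {x : V × ℕ × ℤ}
    (h : ¬ ∃ y, cylinder ⟨b, e⟩ y = x.2) : edgeOp R e ξ x = 0 := by
  by_cases ha : x.1 = a
  · exact (if_pos ha).trans (Function.extend_apply' _ _ _ h)
  · exact if_neg ha

theorem isLeavittFamily_op : IsLeavittFamily V (vertexOp R)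
    (fun {_ _} e => edgeOp R e) (fun {_ _} e => ghostOp R e) where
  idem a := by
    ext ξ x
    by_cases hx : x.1 = a <;> simp [vertexOp_apply, hx]
  orth a b h := by
    ext ξ x
    by_cases hx : x.1 = a
    · simp [vertexOp_apply, hx, h]
    · simp [vertexOp_apply, hx]
  source_edge {a b} e := by
    ext ξ x
    by_cases hx : x.1 = a
    · simp [vertexOp_apply, hx]
    · simp [vertexOp_apply, hx, edgeOp_apply_of_ne]
  edge_range {a b} e := by
    ext ξ ⟨c, y⟩
    by_cases hy : ∃ z, cylinder ⟨b, e⟩ z = y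
    · by_cases hc : c = a
      · obtain ⟨z, rfl⟩ := hy
        subst hc
        simp [edgeOp_apply_cylinder, vertexOp_apply]
      · simp [edgeOp_apply_of_ne, hc]
    · simp [edgeOp_apply_of_notMem R e _ (x := (c, y)) hy]
  range_ghost {a b} e := by
    ext ξ x
    by_cases hx : x.1 = b <;> simp [vertexOp_apply, ghostOp_apply, hx]
  ghost_source {a b} e := by
    ext ξ x
    by_cases hx : x.1 = b <;> simp [vertexOp_apply, ghostOp_apply, hx]
  ghost_edge {a b} e := by
    ext ξ ⟨c, y⟩
    by_cases hx : c = b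
    · subst hx
      simp [vertexOp_apply, ghostOp_apply, edgeOp_apply_cylinder]
    · simp [vertexOp_apply, ghostOp_apply, hx]
  ghost_edge_ne {a b a' b'} e f h := by
    ext ξ ⟨c, y⟩
    by_cases hx : c = b
    · by_cases ha : a = a'
      · subst ha
        have : ¬ ∃ z, cylinder ⟨b', f⟩ z = cylinder ⟨b, e⟩ y := by
          rintro ⟨z, hz⟩
          obtain ⟨h1, -⟩ := cylinder_inj hz
          cases h1
          exact h rfl
        rw [Module.End.mul_apply, ghostOp_apply, edgeOp_apply_of_notMem R f _ this, ite_self]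
        rfl
      · simp [ghostOp_apply, hx, edgeOp_apply_of_ne R f _ (x := (a, _)) ha]
    · simp [ghostOp_apply, hx]
  vertex_eq_sum a _ h := by
    ext ξ ⟨c, y⟩
    rw [LinearMap.sum_apply, Finset.sum_apply]
    by_cases hc : c = a
    · subst hc
      obtain ⟨e, z, rfl⟩ := exists_cylinder_eq h y
      rw [Finset.sum_eq_single e]
      · refine Eq.trans ?_ (edgeOp_apply_cylinder R e.2 (ghostOp R e.2 ξ) z).symm
        simp [vertexOp_apply, ghostOp_apply]
      · intro f _ hf
        refine edgeOp_apply_of_notMem R _ _ ?_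
        rintro ⟨t, ht⟩
        exact hf (cylinder_inj ht).1
      · simp
    · refine (if_neg hc).trans (Finset.sum_eq_zero fun f _ => ?_).symm
      exact edgeOp_apply_of_ne R _ _ hc

variable (V) in
/-- The representation of the Leavitt path algebra by these operators. -/
def rep : LeavittPathAlgebra R V →ₙₐ[R] Module.End R (V × ℕ × ℤ → R) :=
  (existsUnique_lift R (isLeavittFamily_op R)).choose

theorem rep_vertex (a : V) : rep V R (vertex R a) = vertexOp R a :=
  (existsUnique_lift R (isLeavittFamily_op (V := V) R)).choose_spec.1.1 a

theorem rep_ghost {a b : V} (e : a ⟶ b) : rep V R (ghost R e) = ghostOp R e :=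
  (existsUnique_lift R (isLeavittFamily_op (V := V) R)).choose_spec.1.2.2 e

variable {R}

theorem eq_zero_of_smul_vertex_eq_zero {r : R} {a : V} (h : r • vertex R a = 0) : r = 0 := by
  have h1 := congrArg (fun x => rep V R x 1 (a, 0)) h
  simpa [rep_vertex, vertexOp_apply] using h1

theorem vertex_ne_zero [Nontrivial R] (a : V) : vertex R a ≠ 0 := fun h =>
  one_ne_zero (eq_zero_of_smul_vertex_eq_zero (r := (1 : R)) ((one_smul _ _).trans h))

/-- Applying both sides to the constant function 1 and evaluating over `a` turns the equation into
one in R, and the value of `x` there is the inverse. -/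
theorem isUnit_of_smul_eq_vertex {r : R} {a : V} {x : LeavittPathAlgebra R V}
    (h : r • x = vertex R a) : IsUnit r := by
  have h1 := congrArg (fun x => rep V R x 1 (a, 0)) h
  exact IsUnit.of_mul_eq_one (rep V R x 1 (a, 0)) (by simpa [rep_vertex, vertexOp_apply] using h1)

end Representation

/-! ### Paths -/

section Paths

variable (R : Type z) [CommRing R] {V : Type u} [Quiver.{w} V]

/-- A path as an element of the Leavitt path algebra. -/
def path {a : V} : ∀ {b : V}, Quiver.Path a b → LeavittPathAlgebra R V
  | _, .nil => vertex R a
  | _, .cons p e => path p * edge R e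

/-- The ghost path `p*` of a path `p`. -/
def ghostPath {a : V} : ∀ {b : V}, Quiver.Path a b → LeavittPathAlgebra R V
  | _, .nil => vertex R a
  | _, .cons p e => ghost R e * ghostPath p

theorem path_cons {a b c : V} (p : Quiver.Path a b) (e : b ⟶ c) :
    path R (p.cons e) = path R p * edge R e := rfl

theorem ghostPath_cons {a b c : V} (p : Quiver.Path a b) (e : b ⟶ c) :
    ghostPath R (p.cons e) = ghost R e * ghostPath R p := rfl

theorem vertex_mul_vertex (a : V) : vertex R a * vertex R a = vertex R a :=
  (isLeavittFamily R).idem a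

theorem vertex_mul_path {a b : V} (p : Quiver.Path a b) :
    vertex R a * path R p = path R p := by
  induction p with
  | nil => exact vertex_mul_vertex R a
  | cons p e ih => rw [path_cons, ← mul_assoc, ih]

theorem path_mul_vertex {a b : V} (p : Quiver.Path a b) :
    path R p * vertex R b = path R p := by
  cases p with
  | nil => exact vertex_mul_vertex R a
  | cons p e => rw [path_cons, mul_assoc, (isLeavittFamily R).edge_range]

theorem ghostPath_mul_vertex {a b : V} (p : Quiver.Path a b) :
    ghostPath R p * vertex R a = ghostPath R p := by
  induction p with
  | nil => exact vertex_mul_vertex R a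
  | cons p e ih => rw [ghostPath_cons, mul_assoc, ih]

theorem vertex_mul_ghostPath {a b : V} (p : Quiver.Path a b) :
    vertex R b * ghostPath R p = ghostPath R p := by
  cases p with
  | nil => exact vertex_mul_vertex R a
  | cons p e => rw [ghostPath_cons, ← mul_assoc, (isLeavittFamily R).range_ghost]

theorem path_comp {a b c : V} (p : Quiver.Path a b) (q : Quiver.Path b c) :
    path R (p.comp q) = path R p * path R q := by
  induction q with
  | nil => exact (path_mul_vertex R p).symm
  | cons q e ih => rw [Quiver.Path.comp_cons, path_cons, path_cons, ih, mul_assoc]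

theorem ghostPath_comp {a b c : V} (p : Quiver.Path a b) (q : Quiver.Path b c) :
    ghostPath R (p.comp q) = ghostPath R q * ghostPath R p := by
  induction q with
  | nil => exact (vertex_mul_ghostPath R p).symm
  | cons q e ih => rw [Quiver.Path.comp_cons, ghostPath_cons, ghostPath_cons, ih, mul_assoc]

theorem path_toPath {a b : V} (e : a ⟶ b) : path R e.toPath = edge R e :=
  (isLeavittFamily R).source_edge e

theorem ghostPath_mul_path {a b : V} (p : Quiver.Path a b) :
    ghostPath R p * path R p = vertex R b := by
  induction p with
  | nil => exact vertex_mul_vertex R a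
  | @cons b c p e ih =>
    rw [ghostPath_cons, path_cons, mul_assoc, ← mul_assoc _ (path R p), ih,
      (isLeavittFamily R).source_edge, (isLeavittFamily R).ghost_edge]

theorem ghostPath_mul_path_mul {a b : V} (p : Quiver.Path a b) (x : LeavittPathAlgebra R V) :
    ghostPath R p * (path R p * x) = vertex R b * x := by
  rw [← mul_assoc, ghostPath_mul_path]

/-- Paths grow at their range end, but cancellation against ghost edges consumes the first edge,
which is split off here. -/
theorem eq_nil_or_eq_toPath_comp {a b : V} (p : Quiver.Path a b) :
    (∃ h : a = b, p = h ▸ Quiver.Path.nil) ∨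
      ∃ (c : V) (e : a ⟶ c) (q : Quiver.Path c b), p = e.toPath.comp q := by
  induction p with
  | nil => exact .inl ⟨rfl, rfl⟩
  | cons p f ih =>
    right
    rcases ih with ⟨rfl, rfl⟩ | ⟨c, e, q, rfl⟩
    · exact ⟨_, f, .nil, rfl⟩
    · exact ⟨c, e, q.cons f, rfl⟩

/-- Two paths with the same source are comparable or orthogonal. -/
theorem ghostPath_mul_path_cases {a b c : V} (p : Quiver.Path a b) (q : Quiver.Path a c) :
    ghostPath R p * path R q = 0 ∨ (∃ z, q = p.comp z) ∨ ∃ z, p = q.comp z := by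
  induction p with
  | nil => exact .inr (.inl ⟨q, (Quiver.Path.nil_comp q).symm⟩)
  | @cons b d p e ih =>
    rcases ih with h | ⟨z, rfl⟩ | ⟨z, rfl⟩
    · left
      rw [ghostPath_cons, mul_assoc, h, mul_zero]
    -- Compare the new last edge `e` with the first edge of `z`: either `z` is empty, or the edges
    -- agree, or they differ and `e* f = 0`.
    · rcases eq_nil_or_eq_toPath_comp z with ⟨rfl, rfl⟩ | ⟨d', f, z, rfl⟩
      · exact .inr (.inr ⟨e.toPath, rfl⟩)
      · by_cases hef : (⟨b, d, e⟩ : Quiver.Total V) = ⟨b, d', f⟩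
        · cases hef
          exact .inr (.inl ⟨z, by rw [← Quiver.Path.comp_assoc]; rfl⟩)
        · left
          rw [path_comp, path_comp, path_toPath, ghostPath_cons, mul_assoc,
            ghostPath_mul_path_mul, ← mul_assoc (vertex R b),
            (isLeavittFamily R).source_edge, ← mul_assoc,
            (isLeavittFamily R).ghost_edge_ne e f hef, zero_mul]
    · exact .inr (.inr ⟨z.cons e, rfl⟩)

theorem ghostPath_mul_path_of_ne {a a' b c : V} (h : a ≠ a') (p : Quiver.Path a b)
    (q : Quiver.Path a' c) : ghostPath R p * path R q = 0 := by
  rw [← ghostPath_mul_vertex R p, ← vertex_mul_path R q, mul_assoc, ← mul_assoc (vertex R a),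
    (isLeavittFamily R).orth a a' h, zero_mul, mul_zero]

end Paths

/-! ### Ghost paths in the representation, and closed paths -/

section PathOperators

variable {V : Type u} [Quiver.{w} V] [Countable V] [∀ a b : V, Countable (a ⟶ b)]

/-- The cylinder map of a path. -/
def pathCylinder {a : V} : ∀ {b : V}, Quiver.Path a b → ℕ × ℤ → ℕ × ℤ
  | _, .nil, y => y
  | _, .cons p e, y => pathCylinder p (cylinder ⟨_, e⟩ y)

theorem pathCylinder_snd {a b : V} (p : Quiver.Path a b) (y : ℕ × ℤ) :
    (pathCylinder p y).2 = y.2 + p.length := by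
  induction p generalizing y with
  | nil => simp [pathCylinder]
  | cons p e ih => simp [pathCylinder, ih, cylinder]; ring

variable (R : Type z) [CommRing R]

open Classical in
theorem rep_ghostPath {a b : V} (p : Quiver.Path a b) (ξ : V × ℕ × ℤ → R) (x : V × ℕ × ℤ) :
    rep V R (ghostPath R p) ξ x = if x.1 = b then ξ (a, pathCylinder p x.2) else 0 := by
  induction p generalizing x with
  | nil =>
    change rep V R (vertex R a) ξ x = _
    rw [rep_vertex, vertexOp_apply]
    split_ifs with h
    · rw [← h]; rfl
    · rfl
  | cons p e ih =>
    rw [ghostPath_cons, map_mul, Module.End.mul_apply, rep_ghost, ghostOp_apply, ih]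
    simp [pathCylinder]

variable {R}

/-- The two operators are separated by the indicator of degree zero, which p* shifts away from
degree zero. -/
theorem ghostPath_ne_vertex [Nontrivial R] {a : V} {p : Quiver.Path a a} (h : 0 < p.length) :
    ghostPath R p ≠ vertex R a := by
  intro h1
  classical
  have h2 := congrArg
    (fun x => rep V R x (fun x => if x.2.2 = 0 then 1 else 0) (a, 0)) h1
  simp only [rep_ghostPath, rep_vertex, vertexOp_apply, pathCylinder_snd] at h2
  have h3 : p.length ≠ 0 := h.ne'
  simp [h3] at h2

/-- The constant function 1 is killed by the second factor but not by the vertex. This is why the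
representation uses all functions and not only finitely supported ones. -/
theorem mul_vertex_sub_ghostPath_ne_vertex [Nontrivial R] {a : V} (p : Quiver.Path a a)
    (x : LeavittPathAlgebra R V) : x * (vertex R a - ghostPath R p) ≠ vertex R a := by
  intro h
  classical
  have h0 : rep V R (vertex R a - ghostPath R p) 1 = 0 := by
    ext y
    rw [map_sub, LinearMap.sub_apply, Pi.sub_apply, rep_ghostPath, rep_vertex, vertexOp_apply]
    simp
  have h1 := congrArg (fun x => rep V R x 1 (a, 0)) h
  simp only [map_mul, Module.End.mul_apply, h0, map_zero] at h1
  simp [rep_vertex, vertexOp_apply] at h1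

end PathOperators

end

end LeavittPathAlgebra

namespace LeavittPathAlgebra

open Leavitt

noncomputable section

/-! ### Induction on elements -/

section Induction

variable (R : Type z) [CommRing R] {V : Type u} [Quiver.{w} V]

/-- Words are built by multiplying generators on the left. There is no empty word, so single
generators are the base case. -/
theorem induction_gen {motive : LeavittPathAlgebra R V → Prop}
    (add : ∀ x y, motive x → motive y → motive (x + y))
    (smul : ∀ (r : R) x, motive x → motive (r • x))
    (of : ∀ g, motive (mk R V (gen R g)))
    (mul : ∀ g x, motive x → motive (mk R V (gen R g) * x))
    (x : LeavittPathAlgebra R V) (zero : motive 0) : motive x := by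
  obtain ⟨x, rfl⟩ := mk_surjective R x
  induction x using MonoidAlgebra.induction_linear with
  | zero => exact zero
  | add x y hx hy => exact add _ _ hx hy
  | single m r =>
    have key : motive (mk R V (MonoidAlgebra.single m 1)) := by
      induction m using FreeSemigroup.recOnMul with
      | ih1 g => exact of g
      | ih2 g m _ ih =>
        have : (MonoidAlgebra.single (FreeSemigroup.of g * m) 1 : FreeAlg R V) =
            gen R g * MonoidAlgebra.single m 1 := by
          rw [gen, MonoidAlgebra.single_mul_single, one_mul]
        rw [this, mk_mul]
        exact mul _ _ ih
    have := smul r _ key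
    rwa [← mk_smul, MonoidAlgebra.smul_single, smul_eq_mul, mul_one] at this

end Induction

/-! ### The involution -/

section Involution

variable (R : Type z) [CommRing R] {V : Type u} [Quiver.{w} V]

theorem isLeavittFamily_op_ghost : IsLeavittFamily V (fun a : V => MulOpposite.op (vertex R a))
    (fun {_ _} e => MulOpposite.op (ghost R e)) (fun {_ _} e => MulOpposite.op (edge R e)) where
  idem a := congrArg MulOpposite.op ((isLeavittFamily R).idem a)
  orth a b h := congrArg MulOpposite.op ((isLeavittFamily R).orth b a h.symm)
  source_edge e := congrArg MulOpposite.op ((isLeavittFamily R).ghost_source e)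
  edge_range e := congrArg MulOpposite.op ((isLeavittFamily R).range_ghost e)
  range_ghost e := congrArg MulOpposite.op ((isLeavittFamily R).edge_range e)
  ghost_source e := congrArg MulOpposite.op ((isLeavittFamily R).source_edge e)
  ghost_edge e := congrArg MulOpposite.op ((isLeavittFamily R).ghost_edge e)
  ghost_edge_ne e f h := congrArg MulOpposite.op ((isLeavittFamily R).ghost_edge_ne f e h.symm)
  vertex_eq_sum a _ h := by
    rw [(isLeavittFamily R).vertex_eq_sum a h, Finset.op_sum]
    rfl

variable (V) in
/-- The involution, as a homomorphism to the opposite algebra. -/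
def star : LeavittPathAlgebra R V →ₙₐ[R] (LeavittPathAlgebra R V)ᵐᵒᵖ :=
  (existsUnique_lift R (isLeavittFamily_op_ghost R)).choose

theorem star_vertex (a : V) : star R V (vertex R a) = MulOpposite.op (vertex R a) :=
  (existsUnique_lift R (isLeavittFamily_op_ghost (V := V) R)).choose_spec.1.1 a

theorem star_edge {a b : V} (e : a ⟶ b) : star R V (edge R e) = MulOpposite.op (ghost R e) :=
  (existsUnique_lift R (isLeavittFamily_op_ghost (V := V) R)).choose_spec.1.2.1 e

theorem star_ghost {a b : V} (e : a ⟶ b) : star R V (ghost R e) = MulOpposite.op (edge R e) :=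
  (existsUnique_lift R (isLeavittFamily_op_ghost (V := V) R)).choose_spec.1.2.2 e

theorem star_gen_gen (g : Gen V) :
    star R V (star R V (mk R V (gen R g))).unop = MulOpposite.op (mk R V (gen R g)) := by
  cases g with
  | vertex a =>
    change star R V (star R V (vertex R a)).unop = MulOpposite.op (vertex R a)
    rw [star_vertex, MulOpposite.unop_op, star_vertex]
  | edge e =>
    change star R V (star R V (edge R e)).unop = MulOpposite.op (edge R e)
    rw [star_edge, MulOpposite.unop_op, star_ghost]
  | ghost e =>
    change star R V (star R V (ghost R e)).unop = MulOpposite.op (ghost R e)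
    rw [star_ghost, MulOpposite.unop_op, star_edge]

theorem star_star (x : LeavittPathAlgebra R V) :
    star R V (star R V x).unop = MulOpposite.op x := by
  induction x using induction_gen with
  | zero => simp
  | add x y hx hy => simp [hx, hy]
  | smul r x hx => simp [hx]
  | of g => exact star_gen_gen R g
  | mul g x hx => simp [star_gen_gen, hx]

variable (V) in
/-- The involution as an additive automorphism. -/
def starEquiv : LeavittPathAlgebra R V ≃+ LeavittPathAlgebra R V where
  toFun x := (star R V x).unop
  invFun x := (star R V x).unop
  left_inv x := congrArg MulOpposite.unop (star_star R x)
  right_inv x := congrArg MulOpposite.unop (star_star R x)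
  map_add' x y := by simp

theorem starEquiv_mul (x y : LeavittPathAlgebra R V) :
    starEquiv R V (x * y) = starEquiv R V y * starEquiv R V x := by
  simp [starEquiv]

theorem starEquiv_starEquiv (x : LeavittPathAlgebra R V) :
    starEquiv R V (starEquiv R V x) = x := (starEquiv R V).left_inv x

theorem starEquiv_vertex (a : V) : starEquiv R V (vertex R a) = vertex R a :=
  congrArg MulOpposite.unop (star_vertex R a)

end Involution

end

end LeavittPathAlgebra

namespace Leavitt

/-! ### Antiautomorphisms exchange left and right ideals -/

section AntiAutomorphism

variable {A : Type z} [NonUnitalRing A] {σ : A ≃+ A}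

theorem IsRightIdeal.comap (hmul : ∀ x y, σ (x * y) = σ y * σ x) {I : AddSubgroup A}
    (h : IsRightIdeal I) : IsLeftIdeal (I.comap (σ : A →+ A)) := fun a x hx => by
  change σ (a * x) ∈ I
  rw [hmul]
  exact h _ _ hx

theorem IsLeftIdeal.comap (hmul : ∀ x y, σ (x * y) = σ y * σ x) {I : AddSubgroup A}
    (h : IsLeftIdeal I) : IsRightIdeal (I.comap (σ : A →+ A)) := fun a x hx => by
  change σ (x * a) ∈ I
  rw [hmul]
  exact h _ _ hx

theorem comap_comap_eq (hσ : ∀ x, σ (σ x) = x) (I : AddSubgroup A) :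
    (I.comap (σ : A →+ A)).comap (σ : A →+ A) = I := by
  ext x
  change σ (σ x) ∈ I ↔ _
  rw [hσ]

theorem comap_bot_eq : (⊥ : AddSubgroup A).comap (σ : A →+ A) = ⊥ := by
  ext x
  change σ x ∈ (⊥ : AddSubgroup A) ↔ _
  simp

theorem comap_eq_bot_or (hσ : ∀ x, σ (σ x) = x) {I J : AddSubgroup A}
    (h : J.comap (σ : A →+ A) = ⊥ ∨ J.comap (σ : A →+ A) = I) :
    J = ⊥ ∨ J = I.comap (σ : A →+ A) := by
  rcases h with h | h
  · left
    rw [← comap_comap_eq hσ J, h, comap_bot_eq]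
  · right
    rw [← h, comap_comap_eq hσ]

theorem IsMinimalLeftIdeal.comap (hmul : ∀ x y, σ (x * y) = σ y * σ x)
    (hσ : ∀ x, σ (σ x) = x) {I : AddSubgroup A} (h : IsMinimalLeftIdeal I) :
    IsMinimalRightIdeal (I.comap (σ : A →+ A)) := by
  refine ⟨h.1.comap hmul, fun h0 => h.2.1 ?_, fun J hJ hJI => ?_⟩
  · rw [← comap_comap_eq hσ I, h0, comap_bot_eq]
  · refine comap_eq_bot_or hσ (h.2.2 _ (hJ.comap hmul) ?_)
    rw [← comap_comap_eq hσ I]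
    exact AddSubgroup.comap_mono hJI

theorem IsMinimalRightIdeal.comap (hmul : ∀ x y, σ (x * y) = σ y * σ x)
    (hσ : ∀ x, σ (σ x) = x) {I : AddSubgroup A} (h : IsMinimalRightIdeal I) :
    IsMinimalLeftIdeal (I.comap (σ : A →+ A)) := by
  refine ⟨h.1.comap hmul, fun h0 => h.2.1 ?_, fun J hJ hJI => ?_⟩
  · rw [← comap_comap_eq hσ I, h0, comap_bot_eq]
  · refine comap_eq_bot_or hσ (h.2.2 _ (hJ.comap hmul) ?_)
    rw [← comap_comap_eq hσ I]
    exact AddSubgroup.comap_mono hJI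

theorem comap_leftMultiples (hmul : ∀ x y, σ (x * y) = σ y * σ x) (hσ : ∀ x, σ (σ x) = x)
    {x : A} (hx : σ x = x) :
    (leftMultiples x).comap (σ : A →+ A) = rightMultiples x := by
  ext y
  constructor
  · rintro ⟨a, ha⟩
    refine ⟨σ a, ?_⟩
    change a * x = σ y at ha
    change x * σ a = y
    rw [← hσ y, ← ha, hmul, hx]
  · rintro ⟨a, rfl⟩
    refine ⟨σ a, ?_⟩
    change σ a * x = σ (x * a)
    rw [hmul, hx]

/-- An involutive antiautomorphism fixing `x` exchanges Ax and xA, and matches the left ideals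
inside one with the right ideals inside the other. -/
theorem isMinimalRightIdeal_rightMultiples_iff (hmul : ∀ x y, σ (x * y) = σ y * σ x)
    (hσ : ∀ x, σ (σ x) = x) {x : A} (hx : σ x = x) :
    IsMinimalRightIdeal (rightMultiples x) ↔ IsMinimalLeftIdeal (leftMultiples x) := by
  rw [← comap_leftMultiples hmul hσ hx]
  refine ⟨fun h => ?_, fun h => h.comap hmul hσ⟩
  rw [← comap_comap_eq hσ (leftMultiples x)]
  exact h.comap hmul hσ

end AntiAutomorphism

end Leavitt

namespace LeavittPathAlgebra

open Leavitt

noncomputable section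

/-! ### The left ideal of a line point -/

section Span

variable (R : Type z) [CommRing R] {V : Type u} [Quiver.{w} V]

/-- The elements `p q*` of the Leavitt path algebra with `q` a path starting at `v`. -/
def monomials (v : V) : Set (LeavittPathAlgebra R V) :=
  {m | ∃ (a b : V) (p : Quiver.Path a b) (q : Quiver.Path v b), m = path R p * ghostPath R q}

variable {R}

theorem path_mul_ghostPath_mem {v a b : V} (p : Quiver.Path a b) (q : Quiver.Path v b) :
    path R p * ghostPath R q ∈ Submodule.span R (monomials R v) :=
  Submodule.subset_span ⟨a, b, p, q, rfl⟩

theorem vertex_mem_monomials (v : V) : vertex R v ∈ monomials R v :=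
  ⟨v, v, .nil, .nil, (vertex_mul_vertex R v).symm⟩

/-- On a monomial pq*, a vertex acts as the identity or by 0, and an edge lengthens p or gives 0. A
ghost edge strips the first edge of p or gives 0; if p is trivial, it lengthens q instead or gives
0. -/
theorem gen_mul_mem_span {v : V} (g : Gen V) {x : LeavittPathAlgebra R V}
    (hx : x ∈ Submodule.span R (monomials R v)) :
    mk R V (gen R g) * x ∈ Submodule.span R (monomials R v) := by
  induction hx using Submodule.span_induction with
  | zero => simp
  | add x y _ _ hx hy => rw [mul_add]; exact add_mem hx hy
  | smul r x _ hx => rw [mul_smul_comm]; exact Submodule.smul_mem _ _ hx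
  | mem x hx =>
    obtain ⟨a, b, p, q, rfl⟩ := hx
    rw [← mul_assoc]
    cases g with
    | vertex c =>
      change vertex R c * path R p * _ ∈ _
      by_cases h : c = a
      · subst h
        rw [vertex_mul_path]
        exact path_mul_ghostPath_mem p q
      · rw [← vertex_mul_path R p, ← mul_assoc, (isLeavittFamily R).orth c a h]
        simp
    | @edge c d e =>
      change edge R e * path R p * _ ∈ _
      by_cases h : d = a
      · subst h
        rw [← path_toPath, ← path_comp]
        exact path_mul_ghostPath_mem _ q
      · rw [← vertex_mul_path R p, ← mul_assoc, ← (isLeavittFamily R).edge_range e,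
          mul_assoc (edge R e), (isLeavittFamily R).orth d a h]
        simp
    | @ghost c d e =>
      change ghost R e * path R p * _ ∈ _
      rcases eq_nil_or_eq_toPath_comp p with ⟨rfl, rfl⟩ | ⟨b', f, p, rfl⟩
      · change ghost R e * vertex R a * _ ∈ _
        by_cases h : c = a
        · subst h
          rw [(isLeavittFamily R).ghost_source, ← ghostPath_cons, ← vertex_mul_ghostPath]
          exact path_mul_ghostPath_mem .nil _
        · rw [← (isLeavittFamily R).ghost_source e, mul_assoc (ghost R e),
            (isLeavittFamily R).orth c a h]
          simp
      · rw [path_comp, path_toPath, ← mul_assoc]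
        by_cases h : (⟨c, d, e⟩ : Quiver.Total V) = ⟨a, b', f⟩
        · cases h
          rw [(isLeavittFamily R).ghost_edge, vertex_mul_path]
          exact path_mul_ghostPath_mem p q
        · rw [(isLeavittFamily R).ghost_edge_ne e f h]
          simp

theorem mul_vertex_mem_span (v : V) (x : LeavittPathAlgebra R V) :
    x * vertex R v ∈ Submodule.span R (monomials R v) := by
  induction x using induction_gen with
  | zero => simp
  | add x y hx hy => rw [add_mul]; exact add_mem hx hy
  | smul r x hx => rw [smul_mul_assoc]; exact Submodule.smul_mem _ _ hx
  | of g => exact gen_mul_mem_span g (Submodule.subset_span (vertex_mem_monomials v))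
  | mul g x hx => rw [mul_assoc]; exact gen_mul_mem_span g hx

end Span

/-! ### Monomials at a line point as matrix units -/

section LinePoint

variable {R : Type z} [CommRing R] {V : Type u} [Quiver.{w} V] {v : V}

theorem _root_.Leavitt.IsLinePoint.of_path (hv : IsLinePoint v) {a : V} (p : Quiver.Path v a) :
    IsLinePoint a := by
  rintro b ⟨q⟩
  exact hv b ⟨p.comp q⟩

/-- With a single outgoing edge, the sum relation at `v` has one term. -/
theorem edge_mul_ghost (hv : ¬ IsBifurcation v) {a : V} (e : v ⟶ a) :
    edge R e * ghost R e = vertex R v := by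
  let : Unique (OutEdges v) :=
    ⟨⟨⟨a, e⟩⟩, fun f => by_contra fun h => hv ⟨f, ⟨a, e⟩, h⟩⟩
  rw [(isLeavittFamily R).vertex_eq_sum v ⟨⟨a, e⟩⟩, Fintype.sum_unique]
  rfl

theorem path_mul_ghostPath (hv : IsLinePoint v) {a : V} (p : Quiver.Path v a) :
    path R p * ghostPath R p = vertex R v := by
  induction p with
  | nil => exact vertex_mul_vertex R v
  | @cons b c p e ih =>
    rw [path_cons, ghostPath_cons, mul_assoc, ← mul_assoc (edge R e),
      edge_mul_ghost (hv b ⟨p⟩).1, vertex_mul_ghostPath, ih]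

theorem path_eq_nil (hv : IsLinePoint v) (p : Quiver.Path v v) : p = .nil :=
  Quiver.Path.eq_nil_of_length_zero p
    (Nat.eq_zero_of_not_pos fun h => (hv v ⟨.nil⟩).2 ⟨p, h⟩)

/-- A combinatorial fact read off the algebra. If p*q = 0, then q*q = q*(pp*)q = 0, although q*q is
a nonzero vertex. Otherwise one path extends the other by a closed path, which must be trivial. -/
theorem path_unique [Countable V] [∀ a b : V, Countable (a ⟶ b)] (R : Type z) [CommRing R]
    [Nontrivial R] (hv : IsLinePoint v) {a : V} (p q : Quiver.Path v a) : p = q := by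
  rcases ghostPath_mul_path_cases R p q with h | ⟨z, rfl⟩ | ⟨z, rfl⟩
  · refine absurd ?_ (vertex_ne_zero (R := R) a)
    rw [← ghostPath_mul_path R q, ← vertex_mul_path R q, ← path_mul_ghostPath hv p,
      mul_assoc, h, mul_zero, mul_zero]
  · rw [path_eq_nil (hv.of_path p) z, Quiver.Path.comp_nil]
  · rw [path_eq_nil (hv.of_path q) z, Quiver.Path.comp_nil]

variable [Countable V] [∀ a b : V, Countable (a ⟶ b)] [Nontrivial R]

/-- The dual of pq* is qp*. If it does not kill p₁q₁*, then p and p₁ are comparable, say p₁ = pz.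
Uniqueness of paths gives q₁ = qz, and zz* cancels, so p₁q₁* = pq* as elements. -/
theorem exists_dual_monomial (hv : IsLinePoint v) {m : LeavittPathAlgebra R V}
    (hm : m ∈ monomials R v) : ∃ m', m' * m = vertex R v ∧
      ∀ n ∈ monomials R v, n ≠ m → m' * n = 0 := by
  obtain ⟨a, b, p, q, rfl⟩ := hm
  refine ⟨path R q * ghostPath R p, ?_, ?_⟩
  · rw [mul_assoc, ghostPath_mul_path_mul, vertex_mul_ghostPath, path_mul_ghostPath hv]
  · rintro _ ⟨a₁, b₁, p₁, q₁, rfl⟩ hne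
    have key : ghostPath R p * path R p₁ = 0 := by
      by_cases ha : a = a₁
      · subst ha
        rcases ghostPath_mul_path_cases R p p₁ with h | ⟨z, rfl⟩ | ⟨z, rfl⟩
        · exact h
        · refine absurd ?_ hne
          rw [path_unique R hv q₁ (q.comp z), path_comp, ghostPath_comp, mul_assoc,
            ← mul_assoc (path R z), path_mul_ghostPath (hv.of_path q), vertex_mul_ghostPath]
        · refine absurd ?_ hne
          rw [path_unique R hv q (q₁.comp z), path_comp, ghostPath_comp, mul_assoc,
            ← mul_assoc (path R z), path_mul_ghostPath (hv.of_path q₁), vertex_mul_ghostPath]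
      · exact ghostPath_mul_path_of_ne R ha p p₁
    rw [mul_assoc, ← mul_assoc _ (path R p₁), key, zero_mul, mul_zero]

theorem exists_mul_eq_smul_vertex (hv : IsLinePoint v) {x : LeavittPathAlgebra R V}
    (hx : x ∈ Submodule.span R (monomials R v)) (h0 : x ≠ 0) :
    ∃ (y : LeavittPathAlgebra R V) (r : R), r ≠ 0 ∧ y * x = r • vertex R v := by
  obtain ⟨c, hc, rfl⟩ := Submodule.mem_span_set.1 hx
  obtain ⟨m, hm⟩ : c.support.Nonempty := by
    by_contra h
    rw [Finset.not_nonempty_iff_eq_empty, Finsupp.support_eq_empty] at h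
    exact h0 (by simp [h])
  obtain ⟨m', h1, h2⟩ := exists_dual_monomial hv (hc hm)
  refine ⟨m', c m, Finsupp.mem_support_iff.1 hm, ?_⟩
  rw [Finsupp.sum, Finset.mul_sum, Finset.sum_eq_single m]
  · rw [mul_smul_comm, h1]
  · intro n hn hne
    rw [mul_smul_comm, h2 n (hc hn) hne, smul_zero]
  · exact fun h => (h hm).elim

theorem exists_vertex_mul_eq_smul_vertex (hv : IsLinePoint v) {x : LeavittPathAlgebra R V}
    (hx : x ∈ Submodule.span R (monomials R v)) :
    ∃ r : R, vertex R v * x = r • vertex R v := by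
  induction hx using Submodule.span_induction with
  | zero => exact ⟨0, by simp⟩
  | add x y _ _ hx hy =>
    obtain ⟨⟨r, hr⟩, ⟨s, hs⟩⟩ := And.intro hx hy
    exact ⟨r + s, by rw [mul_add, hr, hs, add_smul]⟩
  | smul s x _ hx =>
    obtain ⟨r, hr⟩ := hx
    exact ⟨s * r, by rw [mul_smul_comm, hr, mul_smul]⟩
  | mem m hm =>
    by_cases h : m = vertex R v
    · exact ⟨1, by rw [h, vertex_mul_vertex, one_smul]⟩
    · obtain ⟨a, b, p, q, rfl⟩ := hm
      by_cases ha : v = a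
      · subst ha
        refine absurd ?_ h
        -- Here p and q are parallel paths from `v`, so the monomial is pp* = v.
        rw [path_unique R hv p q, path_mul_ghostPath hv]
      · refine ⟨0, ?_⟩
        rw [← vertex_mul_path R p, ← mul_assoc, ← mul_assoc,
          (isLeavittFamily R).orth v a ha, zero_mul, zero_mul, zero_smul]

end LinePoint

/-! ### Vertices which generate a minimal left ideal -/

section Minimal

variable {R : Type z} [CommRing R] {V : Type u} [Quiver.{w} V] {v : V}

theorem mul_vertex_of_mem_leftMultiples {x : LeavittPathAlgebra R V}
    (h : x ∈ leftMultiples (vertex R v)) : x * vertex R v = x := by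
  obtain ⟨y, rfl⟩ := h
  change y * vertex R v * vertex R v = y * vertex R v
  rw [mul_assoc, vertex_mul_vertex]

theorem vertex_mem_leftMultiples : vertex R v ∈ leftMultiples (vertex R v) :=
  ⟨vertex R v, vertex_mul_vertex R v⟩

theorem isLeftIdeal_leftMultiples (x : LeavittPathAlgebra R V) :
    IsLeftIdeal (leftMultiples x) := by
  rintro a _ ⟨y, rfl⟩
  exact ⟨a * y, mul_assoc a y x⟩

variable (R v) in
/-- Every nonzero element of the corner at `v` generates the left ideal of `v`. -/
def CornerGenerates : Prop := ∀ g : LeavittPathAlgebra R V,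
  vertex R v * g * vertex R v = g → g = 0 ∨ ∃ x, x * g = vertex R v

theorem cornerGenerates_of_isMinimalLeftIdeal
    (h : IsMinimalLeftIdeal (leftMultiples (vertex R v))) : CornerGenerates R v := by
  intro g hg
  have hle : leftMultiples g ≤ leftMultiples (vertex R v) := by
    rintro _ ⟨x, rfl⟩
    refine ⟨x * (vertex R v * g), ?_⟩
    change x * (vertex R v * g) * vertex R v = x * g
    rw [mul_assoc, hg]
  rcases h.2.2 _ (isLeftIdeal_leftMultiples g) hle with h0 | h1
  · left
    -- Without a unit, the vertex acts as a local unit that places g in its own left multiples.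
    have : vertex R v * g ∈ leftMultiples g := ⟨vertex R v, rfl⟩
    rw [h0, AddSubgroup.mem_bot] at this
    rw [← hg, this, zero_mul]
  · right
    have : vertex R v ∈ leftMultiples g := h1 ▸ vertex_mem_leftMultiples
    obtain ⟨x, hx⟩ := this
    exact ⟨x, hx⟩

theorem nontrivial_of_isMinimalLeftIdeal
    (h : IsMinimalLeftIdeal (leftMultiples (vertex R v))) : Nontrivial R := by
  by_contra hR
  rw [not_nontrivial_iff_subsingleton] at hR
  refine h.2.1 ((AddSubgroup.eq_bot_iff_forall _).2 fun x _ => ?_)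
  rw [← one_smul R x, Subsingleton.elim (1 : R) 0, zero_smul]

/-- The map g ↦ pgp* embeds the corner at `a` into the corner at `v`, and y ↦ p*yp undoes it because
p*p is the vertex `a`. -/
theorem CornerGenerates.of_path (h : CornerGenerates R v) {a : V} (p : Quiver.Path v a) :
    CornerGenerates R a := by
  intro g hg
  have hl : vertex R a * g = g := by
    rw [← hg, ← mul_assoc, ← mul_assoc, vertex_mul_vertex]
  have hr : g * vertex R a = g := by
    rw [← hg, mul_assoc, vertex_mul_vertex]
  rcases h (path R p * g * ghostPath R p)
    (by rw [← mul_assoc, ← mul_assoc, vertex_mul_path, mul_assoc, ghostPath_mul_vertex])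
    with h0 | ⟨x, hx⟩
  · left
    calc g = vertex R a * g * vertex R a := hg.symm
      _ = ghostPath R p * (path R p * g * ghostPath R p) * path R p := by
        simp only [mul_assoc, ghostPath_mul_path, ghostPath_mul_path_mul]
      _ = 0 := by rw [h0, mul_zero, zero_mul]
  · right
    refine ⟨ghostPath R p * x * path R p, ?_⟩
    calc ghostPath R p * x * path R p * g
        = ghostPath R p * (x * (path R p * g * ghostPath R p)) * path R p := by
          simp only [mul_assoc, ghostPath_mul_path, hr]
      _ = vertex R a := by
          rw [hx, ghostPath_mul_vertex, ghostPath_mul_path]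

variable [Countable V] [∀ a b : V, Countable (a ⟶ b)] [Nontrivial R]

theorem CornerGenerates.isField (h : CornerGenerates R v) : IsField R := by
  refine ⟨exists_pair_ne R, mul_comm, fun {r} hr => ?_⟩
  rcases h (r • vertex R v)
    (by rw [mul_smul_comm, smul_mul_assoc, vertex_mul_vertex, vertex_mul_vertex]) with h0 | ⟨x, hx⟩
  · exact absurd (eq_zero_of_smul_vertex_eq_zero h0) hr
  · rw [mul_smul_comm] at hx
    exact (isUnit_of_smul_eq_vertex hx).exists_right_inv

theorem CornerGenerates.not_isBifurcation (h : CornerGenerates R v) : ¬ IsBifurcation v := by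
  rintro ⟨⟨a, e⟩, ⟨b, f⟩, hne⟩
  have L := isLeavittFamily R (V := V)
  rcases h (edge R e * ghost R e)
    (by rw [← mul_assoc, L.source_edge, mul_assoc, L.ghost_source]) with h0 | ⟨x, hx⟩
  · refine vertex_ne_zero (R := R) a ?_
    calc vertex R a = ghost R e * (edge R e * ghost R e) * edge R e := by
          rw [← mul_assoc, L.ghost_edge, L.range_ghost, L.ghost_edge]
      _ = 0 := by rw [h0, mul_zero, zero_mul]
  · refine vertex_ne_zero (R := R) b ?_
    have hef : (⟨v, a, e⟩ : Quiver.Total V) ≠ ⟨v, b, f⟩ := by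
      intro h
      cases h
      exact hne rfl
    calc vertex R b = ghost R f * (vertex R v * edge R f) := by
          rw [L.source_edge, L.ghost_edge]
      _ = 0 := by
          rw [← hx, mul_assoc, mul_assoc, L.ghost_edge_ne e f hef, mul_zero, mul_zero, mul_zero]

theorem CornerGenerates.not_isBaseOfClosedPath (h : CornerGenerates R v) :
    ¬ IsBaseOfClosedPath v := by
  rintro ⟨p, hp⟩
  rcases h (vertex R v - ghostPath R p)
    (by rw [mul_sub, sub_mul, vertex_mul_vertex, vertex_mul_vertex, vertex_mul_ghostPath,
      ghostPath_mul_vertex]) with h0 | ⟨x, hx⟩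
  · exact ghostPath_ne_vertex hp (sub_eq_zero.1 h0).symm
  · exact mul_vertex_sub_ghostPath_ne_vertex p x hx

theorem CornerGenerates.isLinePoint (h : CornerGenerates R v) : IsLinePoint v := by
  rintro a ⟨p⟩
  exact ⟨(h.of_path p).not_isBifurcation, (h.of_path p).not_isBaseOfClosedPath⟩

/-- A nonzero element of a smaller left ideal has a left multiple rv with r ≠ 0; inverting r puts
`v` itself into that ideal. -/
theorem isMinimalLeftIdeal_of_isLinePoint (hv : IsLinePoint v) (hR : IsField R) :
    IsMinimalLeftIdeal (leftMultiples (vertex R v)) := by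
  refine ⟨isLeftIdeal_leftMultiples _, fun h => ?_, fun J hJ hle => ?_⟩
  · have : vertex R v ∈ leftMultiples (vertex R v) := vertex_mem_leftMultiples
    rw [h, AddSubgroup.mem_bot] at this
    exact vertex_ne_zero v this
  · refine or_iff_not_imp_left.2 fun hJ0 => le_antisymm hle ?_
    obtain ⟨x, hxJ, hx0⟩ := J.bot_or_exists_ne_zero.resolve_left hJ0
    have hspan := mul_vertex_mem_span v x
    rw [mul_vertex_of_mem_leftMultiples (hle hxJ)] at hspan
    obtain ⟨y, r, hr, hy⟩ := exists_mul_eq_smul_vertex hv hspan hx0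
    obtain ⟨s, hs⟩ := hR.mul_inv_cancel hr
    rintro _ ⟨a, rfl⟩
    refine hJ a _ ?_
    have : (s • y) * x = vertex R v := by
      rw [smul_mul_assoc, hy, ← mul_smul, mul_comm, hs, one_smul]
    exact this ▸ hJ _ _ hxJ

end Minimal

end

end LeavittPathAlgebra

/-! ### The equivalence of the four conditions -/

open LeavittPathAlgebra in
theorem proposition5p5 {V : Type u} [Quiver.{w} V] [Countable V]
    [∀ a b : V, Countable (a ⟶ b)] (R : Type z) [CommRing R] (v : V) :
    List.TFAE
      [Leavitt.IsMinimalLeftIdeal (Leavitt.leftMultiples (LeavittPathAlgebra.vertex R v)),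
       Leavitt.IsMinimalRightIdeal (Leavitt.rightMultiples (LeavittPathAlgebra.vertex R v)),
       Leavitt.IsLinePoint v ∧ IsField R,
       {y : LeavittPathAlgebra R V | ∃ x : LeavittPathAlgebra R V,
            y = LeavittPathAlgebra.vertex R v * x * LeavittPathAlgebra.vertex R v} =
          {y : LeavittPathAlgebra R V | ∃ r : R, y = r • LeavittPathAlgebra.vertex R v} ∧
        IsField R] := by
  tfae_have 2 ↔ 1 := Leavitt.isMinimalRightIdeal_rightMultiples_iff (starEquiv_mul R)
    (starEquiv_starEquiv R) (starEquiv_vertex R v)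
  tfae_have 1 → 3 := fun h => by
    have := nontrivial_of_isMinimalLeftIdeal h
    have hc := cornerGenerates_of_isMinimalLeftIdeal h
    exact ⟨hc.isLinePoint, hc.isField⟩
  tfae_have 3 → 1 := fun h => by
    have := h.2.nontrivial
    exact isMinimalLeftIdeal_of_isLinePoint h.1 h.2
  tfae_have 3 → 4 := fun h => by
    have := h.2.nontrivial
    refine ⟨Set.Subset.antisymm ?_ ?_, h.2⟩
    · rintro _ ⟨x, rfl⟩
      rw [mul_assoc]
      exact exists_vertex_mul_eq_smul_vertex h.1 (mul_vertex_mem_span v x)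
    · rintro _ ⟨r, rfl⟩
      exact ⟨r • vertex R v, by
        rw [mul_smul_comm, smul_mul_assoc, vertex_mul_vertex, vertex_mul_vertex]⟩
  tfae_have 4 → 3 := fun ⟨h, hR⟩ => by
    have := hR.nontrivial
    have hc : CornerGenerates R v := by
      intro g hg
      -- A corner element is a scalar multiple of `v`, so the inverse scalar times `v` carries it
      -- back to `v`.
      obtain ⟨r, rfl⟩ := h.subset ⟨g, hg.symm⟩
      by_cases hr : r = 0
      · exact .inl (by rw [hr, zero_smul])
      · obtain ⟨s, hs⟩ := hR.mul_inv_cancel hr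
        refine .inr ⟨s • vertex R v, ?_⟩
        rw [smul_mul_smul_comm, mul_comm s, hs, one_smul, vertex_mul_vertex]
    exact ⟨hc.isLinePoint, hR⟩
  tfae_finish
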